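/- Let $n$ be a number of parties, each of which has two measurement settings with two outcomes (the $(n,2,2)$ Bell scenario). A box is a family of numbers $p[a_1\dots a_n|x_1\dots x_n]$ with all $x_k,a_k\in\{0,1\}$. For an integer $d\ge 0$ let $\mathcal{Q}_d$ be the set of boxes of the form $$p[a_1\dots a_n|x_1\dots x_n]=\operatorname{Tr}\bigl(\rho\,(A^{1}_{a_1|x_1}\otimes\cdots\otimes A^{n}_{a_n|x_n})\bigr),$$ where $\rho$ is a density matrix on $(\mathbb{C}^d)^{\otimes n}$ and, for each party $k$ and each setting $x$, $(A^{k}_{a|x})_{a\in\{0,1\}}$ is a POVM on $\mathbb{C}^d$. For $N\in\mathbb{N}$ let $\mathcal{L}_N+\mathcal{Q}_d$ be the set of boxes of the form $$p[a_1\dots a_n|x_1\dots x_n]=\sum_{\lambda=0}^{N-1}p[\lambda]\operatorname{Tr}\bigl(\rho^{(\lambda)}\,(A^{1,(\lambda)}_{a_1|x_1}\otimes\cdots\otimes A^{n,(\lambda)}_{a_n|x_n})\bigr),$$ where $(p[\lambda])_\lambda$ is a probability vector and, for each $\lambda$, the state $\rho^{(\lambda)}$ and the POVMs $A^{k,(\lambda)}_{\cdot|x}$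 are as in the definition of $\mathcal{Q}_d$. Let $$|\lambda^\star_{\mathcal{Q}}|_2=\min\{N\in\mathbb{N} : \mathcal{L}_N+\mathcal{Q}_2=\operatorname{conv}\mathcal{Q}_2\}$$ be the quantum Carathéodory number of $\mathcal{Q}_2$. Then: 1. this minimum exists, i.e. $\mathcal{L}_N+\mathcal{Q}_2=\operatorname{conv}\mathcal{Q}_2$ for some $N\in\mathbb{N}$; 2. $\mathcal{Q}_{d'}$ is convex for every integer $d'\ge 2(3^n-1)$; 3. $\mathcal{Q}_{d'}$ is convex for every integer $d'\ge 2\,|\lambda^\star_{\mathcal{Q}}|_2$. -/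

import Mathlib

open scoped ComplexOrder

namespace BellScenario

/-- A box of the `(n, m, v)` Bell scenario: `P x a` is the number `p[a | x]`, where `x k` is the
input and `a k` the output of party `k`. -/
abbrev Box (n m v : ℕ) : Type := (Fin n → Fin m) → (Fin n → Fin v) → ℝ

/-- A density matrix: positive semidefinite with trace one. -/
def IsDensityMatrix {ι : Type} [Fintype ι] (ρ : Matrix ι ι ℂ) : Prop :=
  ρ.PosSemidef ∧ ρ.trace = 1

/-- A POVM with `v` outcomes on `ℂ^d`: positive semidefinite matrices that sum to the identity. -/
def IsPOVM {d v : ℕ} (A : Fin v → Matrix (Fin d) (Fin d) ℂ) : Prop :=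
  (∀ a, (A a).PosSemidef) ∧ ∑ a, A a = 1

/-- The tensor (Kronecker) product of the matrices `M 0, …, M (n - 1)`, acting on `(ℂ^d)^{⊗ n}`,
whose standard basis is indexed by `Fin n → Fin d`. -/
def tensor {n d : ℕ} (M : Fin n → Matrix (Fin d) (Fin d) ℂ) :
    Matrix (Fin n → Fin d) (Fin n → Fin d) ℂ :=
  Matrix.of fun i j => ∏ k, M k (i k) (j k)

/-- A strategy with local dimension `d`: a shared state, and for each party `k` and each input `x`
a POVM `meas k x`. -/
structure Strategy (n m v d : ℕ) where
  state : Matrix (Fin n → Fin d) (Fin n → Fin d) ℂ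
  meas : Fin n → Fin m → Fin v → Matrix (Fin d) (Fin d) ℂ
  isDensityMatrix_state : IsDensityMatrix state
  isPOVM_meas : ∀ k x, IsPOVM (meas k x)

/-- The Born rule `Tr (ρ (A_{a|x} ⊗ B_{b|y} ⊗ …))`. -/
noncomputable def Strategy.prob {n m v d : ℕ} (S : Strategy n m v d)
    (x : Fin n → Fin m) (a : Fin n → Fin v) : ℂ :=
  (S.state * tensor fun k => S.meas k (x k) (a k)).trace

/-- `Q_d`: the boxes obtained from a shared quantum state of local dimension `d`. -/
def quantumSet (n m v d : ℕ) : Set (Box n m v) :=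
  {P | ∃ S : Strategy n m v d, ∀ x a, (P x a : ℂ) = S.prob x a}

/-- `L_N + Q_d`: the boxes obtained when a shared classical random variable with `N` values selects
a strategy of local dimension `d`. -/
def hybridSet (n m v N d : ℕ) : Set (Box n m v) :=
  {P | ∃ p ∈ stdSimplex ℝ (Fin N), ∃ S : Fin N → Strategy n m v d,
    ∀ x a, (P x a : ℂ) = ∑ l, (p l : ℂ) * (S l).prob x a}

/-- The sizes `N` of the shared randomness with which `Q_d` becomes fully convexified. -/
def convexifyingSizes (n m v d : ℕ) : Set ℕ :=
  {N | hybridSet n m v N d = convexHull ℝ (quantumSet n m v d)}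

/-- The quantum Carathéodory number: the least `N` with `L_N + Q_d = conv Q_d`. -/
noncomputable def quantumCaratheodoryNumber (n m v d : ℕ) : ℕ :=
  sInf (convexifyingSizes n m v d)

end BellScenario

/-!
The third claim is the chain `conv Q₂ = L_N + Q₂ ⊆ Q_d' ⊆ conv Q₂` for `N` the quantum Carathéodory
number and `d' ≥ 2 N`, which shows that `Q_d'` is the convex hull of `Q₂`.

The inclusion `L_N + Q_d ⊆ Q_d'` for `N d ≤ d'` (`hybridSet_subset_quantumSet`) stores the shared
random variable in the state: the local spaces contain `N` orthogonal copies of `ℂ^d`, and the state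
is a mixture of states for which all parties are in the same copy.

The inclusion `Q_d' ⊆ conv Q₂` (`quantumSet_subset_convexHull_quantumSet_two`) is Jordan's lemma.
Two measurements with two outcomes are convex combinations of pairs of projective measurements, and two
projections `P` and `R` are block diagonal with blocks of size at most two. This is used in the form
`A x a = ∑ l, V lᴴ * B l x a * V l` with qubit measurements `B l` (`IsQubitSum`), where the `V l`
are written down from an eigenbasis of `P + R - 1`, which anticommutes with `P - R`
(`isQubitSum_of_diagonal`). Compressing the state by tensor products of the `V l` gives unnormalised
states of `n` qubits, whose traces are the probabilities of the shared random variable.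

The first two claims follow once `L_N + Q₂ = conv Q₂` holds for `N = 3 ^ n - 1` when `n ≥ 1`
(`max_one_mem_convexifyingSizes`). A box is a linear function of its `3 ^ n` correlators, one of
which is always `1`. The set of correlators is connected, being a continuous image of a convex set, so the
Fenchel–Bunt theorem (`exists_stdSimplex_of_mem_convexHull_of_isPreconnected`) saves one point
compared to Carathéodory's theorem. For `n = 0` the only box is the constant `1`.
-/

namespace BellScenario

open Matrix

/-! ### Decomposition of measurements into qubit measurements -/

/-- The measurements `A x` (with `A x a` the effect of outcome `a`) are sums of compressed qubit
measurements: `A x a = ∑ l, V lᴴ * B l x a * V l` with finitely many `2 × d` matrices `V l` that do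
not depend on `x` and `a`, and qubit POVMs `B l x`. No normalisation of `V` is imposed, so that
these families form a convex cone. -/
def IsQubitSum {ι : Type} [Fintype ι] {m v : ℕ} (A : Fin m → Fin v → Matrix ι ι ℂ) : Prop :=
  ∃ (Λ : Type) (_ : Fintype Λ) (V : Λ → Matrix (Fin 2) ι ℂ)
    (B : Λ → Fin m → Fin v → Matrix (Fin 2) (Fin 2) ℂ),
    (∀ l x, IsPOVM (B l x)) ∧ ∀ x a, A x a = ∑ l, (V l)ᴴ * B l x a * V l

section

variable {ι κ : Type} [Fintype ι] [Fintype κ] {m v : ℕ}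

theorem IsQubitSum.add {A A' : Fin m → Fin v → Matrix ι ι ℂ} (h : IsQubitSum A)
    (h' : IsQubitSum A') : IsQubitSum (A + A') := by
  obtain ⟨Λ, _, V, B, hB, hA⟩ := h
  obtain ⟨Λ', _, V', B', hB', hA'⟩ := h'
  refine ⟨Λ ⊕ Λ', inferInstance, Sum.elim V V', Sum.elim B B', ?_, ?_⟩
  · rintro (l | l) x
    · exact hB l x
    · exact hB' l x
  · intro x a
    simp [Fintype.sum_sum_type, hA, hA']

theorem IsQubitSum.smul {A : Fin m → Fin v → Matrix ι ι ℂ} (h : IsQubitSum A) {c : ℝ}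
    (hc : 0 ≤ c) : IsQubitSum (c • A) := by
  obtain ⟨Λ, _, V, B, hB, hA⟩ := h
  refine ⟨Λ, inferInstance, fun l => Real.sqrt c • V l, B, hB, fun x a => ?_⟩
  simp only [Pi.smul_apply, hA, Finset.smul_sum]
  refine Finset.sum_congr rfl fun l _ => ?_
  rw [conjTranspose_smul]
  simp only [Matrix.smul_mul, Matrix.mul_smul, smul_smul, star_trivial, Real.mul_self_sqrt hc]

theorem IsQubitSum.conjTranspose_mul_mul_same {A : Fin m → Fin v → Matrix ι ι ℂ}
    (h : IsQubitSum A) (W : Matrix ι κ ℂ) : IsQubitSum fun x a => Wᴴ * A x a * W := by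
  obtain ⟨Λ, _, V, B, hB, hA⟩ := h
  refine ⟨Λ, inferInstance, fun l => V l * W, B, hB, fun x a => ?_⟩
  simp [hA, Matrix.mul_sum, Matrix.sum_mul, conjTranspose_mul, Matrix.mul_assoc]

/-- It suffices that the `V l` resolve the identity and intertwine `A` with qubit measurements. -/
theorem IsQubitSum.of_intertwine [DecidableEq ι] {A : Fin m → Fin v → Matrix ι ι ℂ} {Λ : Type}
    [Fintype Λ] (V : Λ → Matrix (Fin 2) ι ℂ) (B : Λ → Fin m → Fin v → Matrix (Fin 2) (Fin 2) ℂ)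
    (hB : ∀ l x, IsPOVM (B l x)) (hV : ∑ l, (V l)ᴴ * V l = 1)
    (h : ∀ l x a, B l x a * V l = V l * A x a) : IsQubitSum A := by
  refine ⟨Λ, inferInstance, V, B, hB, fun x a => ?_⟩
  simp_rw [Matrix.mul_assoc, h, ← Matrix.mul_assoc]
  rw [← Matrix.sum_mul, hV, Matrix.one_mul]

/-- The two-setting, two-outcome measurements with first effects `P` and `R`. -/
def binary [DecidableEq ι] (P R : Matrix ι ι ℂ) : Fin 2 → Fin 2 → Matrix ι ι ℂ :=
  ![![P, 1 - P], ![R, 1 - R]]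

theorem posSemidef_of_isHermitian_of_mul_self {P : Matrix ι ι ℂ} (hP : P.IsHermitian)
    (hPP : P * P = P) : P.PosSemidef := by
  have h := posSemidef_conjTranspose_mul_self P
  rwa [hP.eq, hPP] at h

theorem posSemidef_one_sub_of_mul_self [DecidableEq ι] {P : Matrix ι ι ℂ} (hP : P.IsHermitian)
    (hPP : P * P = P) : (1 - P).PosSemidef :=
  posSemidef_of_isHermitian_of_mul_self (isHermitian_one.sub hP)
    (by simp [Matrix.mul_sub, Matrix.sub_mul, hPP])

theorem isPOVM_of_mul_self {d : ℕ} {P : Matrix (Fin d) (Fin d) ℂ} (hP : P.IsHermitian)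
    (hPP : P * P = P) : IsPOVM ![P, 1 - P] := by
  refine ⟨fun a => ?_, by simp [Fin.sum_univ_two]⟩
  fin_cases a
  · exact posSemidef_of_isHermitian_of_mul_self hP hPP
  · exact posSemidef_one_sub_of_mul_self hP hPP

/-- The qubit projection `(1 + z σ_z + s σ_x) / 2`. -/
noncomputable def qubitProj (z s : ℝ) : Matrix (Fin 2) (Fin 2) ℂ :=
  !![(1 + z) / 2, s / 2; s / 2, (1 - z) / 2]

theorem isPOVM_qubitProj {z s : ℝ} (h : z ^ 2 + s ^ 2 = 1) :
    IsPOVM ![qubitProj z s, 1 - qubitProj z s] := by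
  have h' : (z : ℂ) ^ 2 + (s : ℂ) ^ 2 = 1 := by exact_mod_cast h
  apply isPOVM_of_mul_self
  · ext i j
    fin_cases i <;> fin_cases j <;> simp [qubitProj]
  · ext i j
    fin_cases i <;> fin_cases j <;> simp [qubitProj, Matrix.mul_apply, Fin.sum_univ_two]
    · linear_combination h' / 4
    · ring
    · ring
    · linear_combination h' / 4

/-- The core of Jordan's lemma, with `P + R - 1` diagonal with entries `z i` and `P - R = X`. The
two matrices anticommute and `X ^ 2 = 1 - z ^ 2`. So `X` maps the basis vector `e i` to an
eigenvector for `-z i` of norm `s = √(1 - z i ^ 2)`, and the matrix `V i` with rows proportional to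
the adjoints of `e i` and `X e i / s` intertwines `P + R - 1` with `z i σ_z` and `P - R` with
`s σ_x`. With weight `1 / 2` for both rows (weight `1` for the first one if `s = 0`), the matrices
`(V i)ᴴ * V i` add up to the identity. -/
theorem isQubitSum_of_diagonal [DecidableEq ι] {z : ι → ℝ} {X : Matrix ι ι ℂ}
    (hX : X.IsHermitian) (hzX : ∀ i j, X i j * (z i + z j) = 0)
    (hXX : X * X = 1 - diagonal fun i => (z i : ℂ) ^ 2) {P R : Matrix ι ι ℂ}
    (hP : P = (1 / 2 : ℂ) • (1 + diagonal (fun i => (z i : ℂ)) + X))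
    (hR : R = (1 / 2 : ℂ) • (1 + diagonal (fun i => (z i : ℂ)) - X)) :
    IsQubitSum (binary P R) := by
  have hXs : ∀ i j, star (X i j) = X j i := fun i j => hX.apply j i
  have hXX' : ∀ i j, ∑ l, X i l * X l j = if i = j then 1 - (z i : ℂ) ^ 2 else 0 := by
    intro i j
    have := congrFun (congrFun hXX i) j
    rw [Matrix.mul_apply] at this
    rw [this]
    by_cases hij : i = j <;> simp [hij]
  have hnorm : ∀ i, ∑ l, ‖X i l‖ ^ 2 = 1 - z i ^ 2 := by
    intro i
    have h1 := hXX' i i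
    have h2 : ∀ l, X i l * X l i = ((‖X i l‖ ^ 2 : ℝ) : ℂ) := by
      intro l
      rw [← hXs i l]
      simpa using Complex.mul_conj' (X i l)
    simp only [h2, if_true] at h1
    exact_mod_cast h1
  have hz : ∀ i, 0 ≤ 1 - z i ^ 2 := fun i => hnorm i ▸ Finset.sum_nonneg fun l _ => by positivity
  let s : ι → ℝ := fun i => Real.sqrt (1 - z i ^ 2)
  have hs : ∀ i, s i ^ 2 = 1 - z i ^ 2 := fun i => Real.sq_sqrt (hz i)
  have hs0 : ∀ i j, s i = 0 → X i j = 0 := by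
    intro i j h
    have h1 := hnorm i
    rw [← hs, h, zero_pow two_ne_zero,
      Finset.sum_eq_zero_iff_of_nonneg fun l _ => by positivity] at h1
    simpa using h1 j (Finset.mem_univ j)
  -- The rows of `V i` are the adjoints of `α i • e i` and `β i • X e i`, with `‖X e i‖ = s i`.
  let α : ι → ℝ := fun i => if s i = 0 then 1 else Real.sqrt (1 / 2)
  let β : ι → ℝ := fun i => if s i = 0 then 0 else Real.sqrt (1 / 2) / s i
  have hαβ : ∀ i, α i ^ 2 + β i ^ 2 * s i ^ 2 = 1 := by
    intro i
    by_cases h : s i = 0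
    · simp [α, β, h]
    · simp only [α, β, h, if_false, div_pow, Real.sq_sqrt (show (0 : ℝ) ≤ 1 / 2 by norm_num)]
      field_simp
      norm_num
  have hαs : ∀ i, β i * s i ^ 2 = α i * s i := by
    intro i
    by_cases h : s i = 0
    · simp [α, β, h]
    · simp only [α, β, h, if_false]
      field_simp
  have hαX : ∀ i j, (α i : ℂ) * X i j = s i * (β i * X i j) := by
    intro i j
    by_cases h : s i = 0
    · simp [hs0 i j h]
    · have : α i = s i * β i := by
        simp only [α, β, h, if_false]
        field_simp
      rw [this]
      push_cast
      ring
  have hβX : ∀ i j, (β i : ℂ) ^ 2 * X i j = β j ^ 2 * X i j := by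
    intro i j
    by_cases h : X i j = 0
    · simp [h]
    · have h1 : z i = -z j := by
        have h1 := (mul_eq_zero.1 (hzX i j)).resolve_left h
        have h2 : z i + z j = 0 := by exact_mod_cast h1
        linarith
      have h2 : s i = s j := by simp [s, h1]
      simp [β, h2]
  have hsC : ∀ i, (s i : ℂ) ^ 2 = 1 - (z i : ℂ) ^ 2 := fun i => by exact_mod_cast hs i
  let V : ι → Matrix (Fin 2) ι ℂ := fun i =>
    Matrix.of ![fun j => if i = j then (α i : ℂ) else 0, fun j => β i * X i j]
  have hVP : ∀ i (t : ℝ), qubitProj (z i) (t * s i) * V i =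
      V i * ((1 / 2 : ℂ) • (1 + diagonal (fun i => (z i : ℂ)) + (t : ℂ) • X)) := by
    intro i t
    have e0 : ∀ j, (V i * X) 0 j = s i * (β i * X i j) := by
      intro j
      simp [V, Matrix.mul_apply, hαX]
    have e1 : ∀ j, (V i * X) 1 j = s i * V i 0 j := by
      intro j
      have h3 : ((β i * s i ^ 2 : ℝ) : ℂ) = ((α i * s i : ℝ) : ℂ) := congrArg _ (hαs i)
      push_cast at h3
      by_cases hij : i = j
      · simp only [V, Matrix.mul_apply, Matrix.of_apply, Matrix.cons_val_one, Matrix.cons_val_zero,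
          mul_assoc, ← Finset.mul_sum, hXX', if_pos hij, ← hsC, h3]
        ring
      · simp only [V, Matrix.mul_apply, Matrix.of_apply, Matrix.cons_val_one, Matrix.cons_val_zero,
          mul_assoc, ← Finset.mul_sum, hXX', if_neg hij, mul_zero]
    ext r j
    rw [Matrix.mul_smul, Matrix.mul_add, Matrix.mul_add, Matrix.mul_smul, Matrix.mul_one]
    simp only [Matrix.smul_apply, Matrix.add_apply, mul_diagonal, smul_eq_mul]
    fin_cases r
    · simp only [Fin.zero_eta, e0]
      by_cases hij : i = j
      · subst hij
        simp [V, qubitProj, Matrix.mul_apply, Fin.sum_univ_two]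
        ring
      · simp [V, qubitProj, Matrix.mul_apply, Fin.sum_univ_two, hij]
        ring
    · simp only [Fin.mk_one, e1]
      simp [V, qubitProj, Matrix.mul_apply, Fin.sum_univ_two]
      split_ifs <;> linear_combination (-(β i : ℂ) / 2) * hzX i j
  have hV : ∑ i, (V i)ᴴ * V i = 1 := by
    ext j k
    have h1 : ∀ i, ((V i)ᴴ * V i) j k =
        (if i = j then (if i = k then (α i : ℂ) ^ 2 else 0) else 0) +
          β k ^ 2 * (X j i * X i k) := by
      intro i
      have h2 : (β i : ℂ) * X j i * (β i * X i k) = β k ^ 2 * (X j i * X i k) := by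
        linear_combination X j i * hβX i k
      simp only [Matrix.mul_apply, Fin.sum_univ_two, conjTranspose_apply, V, Matrix.of_apply,
        Matrix.cons_val_one, Matrix.cons_val_zero, star_mul', hXs]
      rw [← h2]
      by_cases hik : i = k
      · subst hik
        by_cases hij : i = j <;> simp [hij, pow_two]
      · simp [hik]
    have h3 : ((α k ^ 2 + β k ^ 2 * s k ^ 2 : ℝ) : ℂ) = 1 := by rw [hαβ]; simp
    push_cast at h3
    rw [Matrix.sum_apply]
    simp only [h1, Finset.sum_add_distrib, ← Finset.mul_sum, hXX', Finset.sum_ite_eq',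
      Finset.mem_univ, if_true, Matrix.one_apply]
    by_cases hjk : j = k
    · subst hjk
      simpa [← hsC] using h3
    · simp [hjk]
  have hp : ∀ i, qubitProj (z i) (s i) * V i = V i * P := by
    intro i
    simpa [hP] using hVP i 1
  have hr : ∀ i, qubitProj (z i) (-s i) * V i = V i * R := by
    intro i
    simpa [hR, sub_eq_add_neg] using hVP i (-1)
  refine IsQubitSum.of_intertwine V
    (fun i => binary (qubitProj (z i) (s i)) (qubitProj (z i) (-s i))) (fun i x => ?_) hV
    (fun i x a => ?_)
  · fin_cases x
    · exact isPOVM_qubitProj (by rw [hs]; ring)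
    · exact isPOVM_qubitProj (by rw [neg_sq, hs]; ring)
  · fin_cases x <;> fin_cases a <;>
      simp [binary, Matrix.sub_mul, Matrix.mul_sub, hp, hr]

/-- Jordan's lemma: a pair of projections is block diagonal with blocks of size at most two. -/
theorem isQubitSum_of_projections [DecidableEq ι] {P R : Matrix ι ι ℂ} (hP : P.IsHermitian)
    (hPP : P * P = P) (hR : R.IsHermitian) (hRR : R * R = R) : IsQubitSum (binary P R) := by
  have hZ : (P + R - 1).IsHermitian := (hP.add hR).sub isHermitian_one
  let U : Matrix ι ι ℂ := hZ.eigenvectorUnitary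
  let z := hZ.eigenvalues
  have hU1 : Uᴴ * U = 1 := Unitary.coe_star_mul_self hZ.eigenvectorUnitary
  have hU2 : U * Uᴴ = 1 := Unitary.coe_mul_star_self hZ.eigenvectorUnitary
  have hspec : P + R - 1 = U * diagonal (fun i => (z i : ℂ)) * Uᴴ := hZ.spectral_theorem
  have hdiag : Uᴴ * (P + R - 1) * U = diagonal (fun i => (z i : ℂ)) := by
    rw [hspec]
    calc _ = Uᴴ * U * diagonal (fun i => (z i : ℂ)) * (Uᴴ * U) := by simp only [Matrix.mul_assoc]
      _ = _ := by simp [hU1]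
  have hmul : ∀ M N : Matrix ι ι ℂ, (Uᴴ * M * U) * (Uᴴ * N * U) = Uᴴ * (M * N) * U := by
    intro M N
    calc _ = Uᴴ * M * (U * Uᴴ) * N * U := by simp only [Matrix.mul_assoc]
      _ = _ := by simp only [hU2, Matrix.mul_one, Matrix.mul_assoc]
  have key : IsQubitSum (binary (Uᴴ * P * U) (Uᴴ * R * U)) := by
    have hadd : (1 : Matrix ι ι ℂ) + diagonal (fun i => (z i : ℂ)) = Uᴴ * (P + R) * U := by
      rw [← hdiag, Matrix.mul_sub, Matrix.sub_mul, Matrix.mul_one, hU1]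
      abel
    refine isQubitSum_of_diagonal (z := z) (X := Uᴴ * (P - R) * U)
      (isHermitian_conjTranspose_mul_mul U (hP.sub hR)) ?_ ?_ ?_ ?_
    · have h : diagonal (fun i => (z i : ℂ)) * (Uᴴ * (P - R) * U) +
          (Uᴴ * (P - R) * U) * diagonal (fun i => (z i : ℂ)) = 0 := by
        rw [← hdiag, hmul, hmul, ← Matrix.add_mul, ← Matrix.mul_add]
        have : (P + R - 1) * (P - R) + (P - R) * (P + R - 1) = 0 := by
          simp only [Matrix.mul_sub, Matrix.sub_mul, Matrix.mul_add, Matrix.add_mul, hPP, hRR,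
            Matrix.mul_one, Matrix.one_mul]
          abel
        rw [this]
        simp
      intro i j
      have h2 := congrFun (congrFun h i) j
      rw [Matrix.add_apply, diagonal_mul, mul_diagonal, Matrix.zero_apply] at h2
      linear_combination h2
    · have h3 : (diagonal fun i => (z i : ℂ) ^ 2) =
          diagonal (fun i => (z i : ℂ)) * diagonal (fun i => (z i : ℂ)) := by
        simp [diagonal_mul_diagonal, pow_two]
      have h4 : (P - R) * (P - R) + (P + R - 1) * (P + R - 1) = 1 := by
        simp only [Matrix.mul_sub, Matrix.sub_mul, Matrix.mul_add, Matrix.add_mul, hPP, hRR,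
          Matrix.mul_one, Matrix.one_mul]
        abel
      rw [h3, ← hdiag, hmul, hmul, eq_sub_iff_add_eq, ← Matrix.add_mul, ← Matrix.mul_add, h4,
        Matrix.mul_one, hU1]
    · rw [hadd, ← Matrix.add_mul, ← Matrix.mul_add]
      have : P + R + (P - R) = (2 : ℂ) • P := by rw [two_smul]; abel
      rw [this, Matrix.mul_smul, Matrix.smul_mul, smul_smul]
      norm_num
    · rw [hadd, ← Matrix.sub_mul, ← Matrix.mul_sub]
      have : P + R - (P - R) = (2 : ℂ) • R := by rw [two_smul]; abel
      rw [this, Matrix.mul_smul, Matrix.smul_mul, smul_smul]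
      norm_num
  have hback : ∀ M : Matrix ι ι ℂ, U * (Uᴴ * M * U) * Uᴴ = M := by
    intro M
    calc _ = (U * Uᴴ) * M * (U * Uᴴ) := by simp only [Matrix.mul_assoc]
      _ = _ := by simp [hU2]
  convert key.conjTranspose_mul_mul_same Uᴴ using 1
  funext x a
  fin_cases x <;> fin_cases a <;>
    simp only [binary, Fin.zero_eta, Fin.mk_one, Matrix.cons_val_zero, Matrix.cons_val_one,
      Matrix.mul_sub, Matrix.sub_mul, hback, Matrix.mul_one, conjTranspose_conjTranspose, hU2]

/-- An effect is a convex combination of projections, as `[0, 1] ^ d` is the convex hull of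
`{0, 1} ^ d`. -/
theorem mem_convexHull_projections [DecidableEq ι] {A : Matrix ι ι ℂ} (hA : A.PosSemidef)
    (hA' : (1 - A).PosSemidef) :
    A ∈ convexHull ℝ {P : Matrix ι ι ℂ | P.IsHermitian ∧ P * P = P} := by
  let U : Matrix ι ι ℂ := hA.isHermitian.eigenvectorUnitary
  let z := hA.isHermitian.eigenvalues
  have hU1 : Uᴴ * U = 1 := Unitary.coe_star_mul_self hA.isHermitian.eigenvectorUnitary
  have hspec : A = U * diagonal (fun i => (z i : ℂ)) * Uᴴ := hA.isHermitian.spectral_theorem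
  have hz0 : ∀ i, 0 ≤ z i := hA.eigenvalues_nonneg
  have hz1 : ∀ i, z i ≤ 1 := by
    intro i
    have h := (hA'.conjTranspose_mul_mul_same U).diag_nonneg (i := i)
    have h1 : Uᴴ * (1 - A) * U = 1 - diagonal (fun i => (z i : ℂ)) := by
      rw [hspec, Matrix.mul_sub, Matrix.sub_mul, Matrix.mul_one, hU1]
      congr 1
      calc _ = Uᴴ * U * diagonal (fun i => (z i : ℂ)) * (Uᴴ * U) := by simp only [Matrix.mul_assoc]
        _ = _ := by simp [hU1]
    rw [h1, Matrix.sub_apply, Matrix.one_apply_eq, diagonal_apply_eq] at h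
    have h2 : ((z i : ℝ) : ℂ) ≤ ((1 : ℝ) : ℂ) := by simpa using h
    exact_mod_cast h2
  let L : (ι → ℝ) →ₗ[ℝ] Matrix ι ι ℂ :=
    { toFun := fun w => U * diagonal (fun i => (w i : ℂ)) * Uᴴ
      map_add' := fun w w' => by
        rw [← Matrix.add_mul, ← Matrix.mul_add, diagonal_add]
        simp
      map_smul' := fun c w => by
        rw [RingHom.id_apply, ← Matrix.smul_mul, ← Matrix.mul_smul, ← diagonal_smul]
        congr
        funext i
        simp }
  have hzm : z ∈ convexHull ℝ (Set.univ.pi fun _ : ι => ({0, 1} : Set ℝ)) := by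
    rw [convexHull_pi]
    intro i _
    rw [convexHull_pair, segment_eq_Icc zero_le_one]
    exact ⟨hz0 i, hz1 i⟩
  have hAL : A = L z := hspec
  rw [hAL]
  refine convexHull_mono ?_ ((L.image_convexHull _) ▸ Set.mem_image_of_mem L hzm)
  rintro _ ⟨w, hw, rfl⟩
  have hw' : ∀ i, w i * w i = w i := by
    intro i
    rcases hw i (Set.mem_univ i) with h | h <;> simp_all
  refine ⟨isHermitian_mul_mul_conjTranspose U ?_, ?_⟩
  · rw [IsHermitian, diagonal_conjTranspose]
    congr 1
    funext i
    simp
  · change U * diagonal (fun i => (w i : ℂ)) * Uᴴ * (U * diagonal (fun i => (w i : ℂ)) * Uᴴ) =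
      U * diagonal (fun i => (w i : ℂ)) * Uᴴ
    calc _ = U * diagonal (fun i => (w i : ℂ)) * (Uᴴ * U) * diagonal (fun i => (w i : ℂ)) * Uᴴ := by
          simp only [Matrix.mul_assoc]
      _ = _ := by
        rw [hU1, Matrix.mul_one, Matrix.mul_assoc U, diagonal_mul_diagonal]
        simp_rw [← Complex.ofReal_mul, hw']

theorem convex_setOf_isQubitSum_binary [DecidableEq ι] :
    Convex ℝ {A : Matrix ι ι ℂ × Matrix ι ι ℂ | IsQubitSum (binary A.1 A.2)} := by
  rintro ⟨A, A'⟩ h ⟨B, B'⟩ h' s t hs ht hst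
  have h1 := (IsQubitSum.smul h hs).add (IsQubitSum.smul h' ht)
  change IsQubitSum (binary (s • A + t • B) (s • A' + t • B'))
  convert h1 using 1
  have hone : (1 : Matrix ι ι ℂ) = s • 1 + t • 1 := by rw [← add_smul, hst, one_smul]
  funext x a
  fin_cases x <;> fin_cases a <;> simp [binary, smul_sub] <;> nth_rw 1 [hone] <;> abel

end

/-- Two measurements with two outcomes each are sums of compressed qubit measurements. -/
theorem isQubitSum_of_isPOVM {d : ℕ} {A : Fin 2 → Fin 2 → Matrix (Fin d) (Fin d) ℂ}
    (hA : ∀ x, IsPOVM (A x)) : IsQubitSum A := by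
  have h1 : ∀ x, A x 1 = 1 - A x 0 := by
    intro x
    rw [← (hA x).2, Fin.sum_univ_two]
    abel
  have hmem : ∀ x, A x 0 ∈ convexHull ℝ
      {P : Matrix (Fin d) (Fin d) ℂ | P.IsHermitian ∧ P * P = P} := fun x =>
    mem_convexHull_projections ((hA x).1 0) (h1 x ▸ (hA x).1 1)
  have hpair : (A 0 0, A 1 0) ∈ convexHull ℝ
      ({P : Matrix (Fin d) (Fin d) ℂ | P.IsHermitian ∧ P * P = P} ×ˢ
        {P : Matrix (Fin d) (Fin d) ℂ | P.IsHermitian ∧ P * P = P}) := by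
    rw [convexHull_prod]
    exact ⟨hmem 0, hmem 1⟩
  have key : IsQubitSum (binary (A 0 0) (A 1 0)) :=
    convexHull_min (t := {A : Matrix (Fin d) (Fin d) ℂ × Matrix (Fin d) (Fin d) ℂ |
      IsQubitSum (binary A.1 A.2)})
      (fun Q hQ => isQubitSum_of_projections hQ.1.1 hQ.1.2 hQ.2.1 hQ.2.2)
      convex_setOf_isQubitSum_binary hpair
  convert key using 1
  funext x a
  fin_cases x <;> fin_cases a <;> simp [binary, h1]

/-! ### Tensor products of rectangular matrices -/

/-- The tensor product of rectangular matrices `M 0, …, M (n - 1)`, generalising `tensor`. -/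
def rectTensor {n : ℕ} {α β : Type} (M : Fin n → Matrix α β ℂ) :
    Matrix (Fin n → α) (Fin n → β) ℂ :=
  Matrix.of fun i j => ∏ k, M k (i k) (j k)

section

variable {n : ℕ} {α β γ : Type}

theorem tensor_eq_rectTensor {d : ℕ} (M : Fin n → Matrix (Fin d) (Fin d) ℂ) :
    tensor M = rectTensor M := rfl

theorem rectTensor_mul [Fintype β] (M : Fin n → Matrix α β ℂ) (N : Fin n → Matrix β γ ℂ) :
    rectTensor M * rectTensor N = rectTensor fun k => M k * N k := by
  ext i j
  simp only [Matrix.mul_apply, rectTensor, Matrix.of_apply, Fintype.prod_sum,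
    Finset.prod_mul_distrib]

theorem conjTranspose_rectTensor (M : Fin n → Matrix α β ℂ) :
    (rectTensor M)ᴴ = rectTensor fun k => (M k)ᴴ := by
  ext i j
  simp [rectTensor]

theorem rectTensor_one [DecidableEq α] : rectTensor (fun _ : Fin n => (1 : Matrix α α ℂ)) = 1 := by
  ext i j
  simp only [rectTensor, Matrix.of_apply, Matrix.one_apply, Finset.prod_ite_zero, funext_iff]
  simp

theorem rectTensor_sum {Λ : Fin n → Type} [∀ k, Fintype (Λ k)]
    (M : ∀ k, Λ k → Matrix α β ℂ) :
    rectTensor (fun k => ∑ l, M k l) = ∑ f : ∀ k, Λ k, rectTensor fun k => M k (f k) := by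
  ext i j
  simp only [rectTensor, Matrix.of_apply, Matrix.sum_apply, Fintype.prod_sum]

theorem exists_eq_conjTranspose_mul_self [Fintype α] {A : Matrix α α ℂ} (hA : A.PosSemidef) :
    ∃ C : Matrix α α ℂ, A = Cᴴ * C := by
  classical
  open scoped MatrixOrder in
  exact CStarAlgebra.nonneg_iff_eq_star_mul_self.1 hA.nonneg

theorem posSemidef_rectTensor [Fintype α] {M : Fin n → Matrix α α ℂ}
    (hM : ∀ k, (M k).PosSemidef) : (rectTensor M).PosSemidef := by
  choose C hC using fun k => exists_eq_conjTranspose_mul_self (hM k)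
  have h : rectTensor M = (rectTensor C)ᴴ * rectTensor C := by
    rw [conjTranspose_rectTensor, rectTensor_mul]
    exact congrArg _ (funext hC)
  rw [h]
  exact posSemidef_conjTranspose_mul_self _

end

/-! ### Boxes of strategies -/

theorem trace_mul_nonneg {ι : Type} [Fintype ι] {A B : Matrix ι ι ℂ} (hA : A.PosSemidef)
    (hB : B.PosSemidef) : 0 ≤ (A * B).trace := by
  obtain ⟨C, rfl⟩ := exists_eq_conjTranspose_mul_self hB
  rw [← Matrix.mul_assoc, trace_mul_comm, ← Matrix.mul_assoc]
  exact (hA.mul_mul_conjTranspose_same C).trace_nonneg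

/-- Every nonzero positive semidefinite matrix is a multiple of a density matrix; for the zero
matrix any density matrix serves. -/
theorem exists_isDensityMatrix_smul {ι : Type} [Fintype ι] [Nonempty ι] {σ : Matrix ι ι ℂ}
    (hσ : σ.PosSemidef) : ∃ ρ, IsDensityMatrix ρ ∧ σ = σ.trace • ρ := by
  classical
  by_cases h : σ.trace = 0
  · let i : ι := Classical.arbitrary ι
    refine ⟨diagonal (Pi.single i 1), ⟨posSemidef_diagonal_iff.2 fun j => ?_, ?_⟩, ?_⟩
    · by_cases hj : j = i
      · subst hj
        simp
      · simp [hj]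
    · simp [trace_diagonal]
    · rw [h, zero_smul]
      exact hσ.trace_eq_zero_iff.1 h
  · refine ⟨σ.trace⁻¹ • σ, ⟨hσ.smul (inv_nonneg.2 hσ.trace_nonneg), ?_⟩, ?_⟩
    · rw [trace_smul, smul_eq_mul, inv_mul_cancel₀ h]
    · rw [smul_smul, mul_inv_cancel₀ h, one_smul]

namespace Strategy

variable {n m v d : ℕ}

theorem prob_nonneg (S : Strategy n m v d) (x : Fin n → Fin m) (a : Fin n → Fin v) :
    0 ≤ S.prob x a :=
  trace_mul_nonneg S.isDensityMatrix_state.1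
    (posSemidef_rectTensor fun k => (S.isPOVM_meas k (x k)).1 (a k))

/-- The box of a strategy. -/
noncomputable def box (S : Strategy n m v d) : Box n m v := fun x a => (S.prob x a).re

theorem ofReal_box (S : Strategy n m v d) (x : Fin n → Fin m) (a : Fin n → Fin v) :
    (S.box x a : ℂ) = S.prob x a :=
  Complex.ext rfl (Complex.nonneg_iff.1 (S.prob_nonneg x a)).2

theorem box_mem_quantumSet (S : Strategy n m v d) : S.box ∈ quantumSet n m v d :=
  ⟨S, S.ofReal_box⟩

end Strategy

section

variable {n m v N d : ℕ}

theorem mem_quantumSet_iff {P : Box n m v} :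
    P ∈ quantumSet n m v d ↔ ∃ S : Strategy n m v d, P = S.box := by
  constructor
  · rintro ⟨S, hS⟩
    refine ⟨S, funext fun x => funext fun a => ?_⟩
    rw [Strategy.box, ← hS, Complex.ofReal_re]
  · rintro ⟨S, rfl⟩
    exact S.box_mem_quantumSet

theorem mem_hybridSet_iff {P : Box n m v} :
    P ∈ hybridSet n m v N d ↔
      ∃ p ∈ stdSimplex ℝ (Fin N), ∃ S : Fin N → Strategy n m v d, P = ∑ l, p l • (S l).box := by
  refine exists_congr fun p => and_congr_right fun _ => exists_congr fun S => ?_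
  simp only [funext_iff, Finset.sum_apply, Pi.smul_apply, smul_eq_mul, ← Strategy.ofReal_box]
  exact_mod_cast Iff.rfl

theorem hybridSet_subset_convexHull :
    hybridSet n m v N d ⊆ convexHull ℝ (quantumSet n m v d) := by
  intro P hP
  obtain ⟨p, hp, S, rfl⟩ := mem_hybridSet_iff.1 hP
  exact (convex_convexHull ℝ _).sum_mem (fun l _ => hp.1 l) hp.2
    fun l _ => subset_convexHull ℝ _ (S l).box_mem_quantumSet

end

/-! ### Reduction to qubits -/

/-- With two settings and two outcomes, shared randomness and qubits reproduce every quantum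
box: each party applies the instrument with Kraus operators `V l`, and the joint outcome selects the
qubit state and measurements. -/
theorem quantumSet_subset_convexHull_quantumSet_two (n d : ℕ) :
    quantumSet n 2 2 d ⊆ convexHull ℝ (quantumSet n 2 2 2) := by
  intro P hP
  obtain ⟨S, rfl⟩ := mem_quantumSet_iff.1 hP
  choose Λ _ V B hB hA using fun k => isQubitSum_of_isPOVM (S.isPOVM_meas k)
  let W : (∀ k, Λ k) → Matrix (Fin n → Fin 2) (Fin n → Fin d) ℂ :=
    fun f => rectTensor fun k => V k (f k)
  let σ : (∀ k, Λ k) → Matrix (Fin n → Fin 2) (Fin n → Fin 2) ℂ :=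
    fun f => W f * S.state * (W f)ᴴ
  have hσ : ∀ f, (σ f).PosSemidef := fun f =>
    S.isDensityMatrix_state.1.mul_mul_conjTranspose_same (W f)
  choose ρ hρ hσρ using fun f => exists_isDensityMatrix_smul (hσ f)
  let T : (∀ k, Λ k) → Strategy n 2 2 2 := fun f =>
    { state := ρ f
      meas := fun k => B k (f k)
      isDensityMatrix_state := hρ f
      isPOVM_meas := fun k => hB k (f k) }
  have hVV : ∀ k, ∑ l, (V k l)ᴴ * V k l = 1 := by
    intro k
    rw [← (S.isPOVM_meas k 0).2]
    simp_rw [hA]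
    rw [Finset.sum_comm]
    refine Finset.sum_congr rfl fun l _ => ?_
    rw [← Matrix.sum_mul, ← Matrix.mul_sum, (hB k l 0).2, Matrix.mul_one]
  have hWW : ∑ f, (W f)ᴴ * W f = 1 := by
    simp only [W, conjTranspose_rectTensor, rectTensor_mul]
    rw [← rectTensor_sum fun k l => (V k l)ᴴ * V k l]
    simp_rw [hVV]
    exact rectTensor_one
  have htr : ∀ f, 0 ≤ (σ f).trace := fun f => (hσ f).trace_nonneg
  have htr' : ∀ f, (((σ f).trace.re : ℝ) : ℂ) = (σ f).trace := fun f =>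
    Complex.ext rfl (Complex.nonneg_iff.1 (htr f)).2
  have hsum : ∑ f, (σ f).trace = 1 := by
    have h : ∀ f, (σ f).trace = (S.state * ((W f)ᴴ * W f)).trace := by
      intro f
      rw [← Matrix.mul_assoc, trace_mul_comm _ (W f), ← Matrix.mul_assoc]
    simp_rw [h]
    rw [← trace_sum, ← Matrix.mul_sum, hWW, Matrix.mul_one, S.isDensityMatrix_state.2]
  have hprob : ∀ x a, S.prob x a = ∑ f, (σ f).trace * (T f).prob x a := by
    intro x a
    have h1 : tensor (fun k => S.meas k (x k) (a k)) =
        ∑ f, (W f)ᴴ * tensor (fun k => (T f).meas k (x k) (a k)) * W f := by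
      simp only [tensor_eq_rectTensor, W, conjTranspose_rectTensor, rectTensor_mul, T, hA]
      exact rectTensor_sum fun k l => (V k l)ᴴ * B k l (x k) (a k) * V k l
    rw [Strategy.prob, h1, Matrix.mul_sum, trace_sum]
    refine Finset.sum_congr rfl fun f _ => ?_
    calc _ = (σ f * tensor (fun k => (T f).meas k (x k) (a k))).trace := by
          rw [← Matrix.mul_assoc, trace_mul_comm _ (W f)]
          simp only [σ, Matrix.mul_assoc]
      _ = ((σ f).trace • (ρ f * tensor (fun k => (T f).meas k (x k) (a k)))).trace := by
          rw [← Matrix.smul_mul, ← hσρ]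
      _ = _ := by rw [trace_smul, smul_eq_mul]; rfl
  have hbox : S.box = ∑ f, (σ f).trace.re • (T f).box := by
    funext x a
    have h : (S.box x a : ℂ) = ((∑ f, (σ f).trace.re • (T f).box) x a : ℝ) := by
      simp only [Finset.sum_apply, Pi.smul_apply, smul_eq_mul, Complex.ofReal_sum,
        Complex.ofReal_mul, htr', Strategy.ofReal_box, hprob]
    exact_mod_cast h
  rw [hbox]
  refine (convex_convexHull ℝ _).sum_mem (fun f _ => (Complex.nonneg_iff.1 (htr f)).1) ?_
    fun f _ => subset_convexHull ℝ _ (T f).box_mem_quantumSet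
  have h := congrArg Complex.re hsum
  simpa using h

/-! ### Storing shared randomness in the local dimension -/

/-- Shared randomness with `N` values can be stored in the state when the local dimension grows by
the factor `N`: every party has `N` orthogonal copies of `ℂ^d` and all parties hold the same
copy. -/
theorem hybridSet_subset_quantumSet {n m v N d d' : ℕ} [NeZero v] (h : N * d ≤ d') :
    hybridSet n m v N d ⊆ quantumSet n m v d' := by
  intro P hP
  obtain ⟨p, hp, S, hPS⟩ := hP
  let e : Fin N × Fin d → Fin d' := fun q => Fin.castLE h (finProdFinEquiv q)
  have he : Function.Injective e := (Fin.castLE_injective h).comp finProdFinEquiv.injective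
  let J : Fin N → Matrix (Fin d') (Fin d) ℂ := fun l =>
    Matrix.of fun i j => if i = e (l, j) then 1 else 0
  have hJJ : ∀ l l', (J l)ᴴ * J l' = if l = l' then 1 else 0 := by
    intro l l'
    ext i j
    simp only [J, Matrix.mul_apply, conjTranspose_apply, Matrix.of_apply, mul_ite, mul_one,
      mul_zero, Finset.sum_ite_eq', Finset.mem_univ, if_true]
    by_cases hl : l = l'
    · subst hl
      by_cases hij : i = j
      · subst hij
        simp
      · have : e (l, j) ≠ e (l, i) := fun h => hij (Prod.ext_iff.1 (he h)).2.symm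
        simp [hij, this]
    · have : e (l', j) ≠ e (l, i) := fun h => hl (Prod.ext_iff.1 (he h)).1.symm
      simp [hl, this]
  let K : Matrix (Fin d') (Fin d') ℂ := ∑ l, J l * (J l)ᴴ
  have hJK : ∀ l, K * J l = J l := by
    intro l
    simp only [K, Matrix.sum_mul, Matrix.mul_assoc, hJJ]
    rw [Finset.sum_eq_single l] <;> simp +contextual
  have hK : K.IsHermitian := by
    simp [K, IsHermitian, conjTranspose_sum, conjTranspose_mul]
  have hKK : K * K = K := by
    have : K * K = ∑ l, K * J l * (J l)ᴴ := by
      conv_lhs => rw [show K * K = K * ∑ l, J l * (J l)ᴴ from rfl, Matrix.mul_sum]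
      simp only [Matrix.mul_assoc]
    rw [this]
    simp only [hJK, K]
  -- The complement of the `N` copies carries no state; there the outcome is always `0`.
  let M : Fin n → Fin m → Fin v → Matrix (Fin d') (Fin d') ℂ := fun k x a =>
    ∑ l, J l * (S l).meas k x a * (J l)ᴴ + if a = 0 then 1 - K else 0
  have hJM : ∀ l k x a, (J l)ᴴ * M k x a * J l = (S l).meas k x a := by
    intro l k x a
    have h1 : (if a = 0 then 1 - K else 0) * J l = 0 := by
      split_ifs
      · rw [Matrix.sub_mul, hJK, Matrix.one_mul, sub_self]
      · exact Matrix.zero_mul _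
    have h2 : M k x a * J l = J l * (S l).meas k x a := by
      simp only [M]
      rw [Matrix.add_mul, h1, add_zero, Matrix.sum_mul]
      simp only [Matrix.mul_assoc, hJJ]
      rw [Finset.sum_eq_single l] <;> simp +contextual
    rw [Matrix.mul_assoc, h2, ← Matrix.mul_assoc, hJJ]
    simp
  have hM : ∀ k x, IsPOVM (M k x) := by
    refine fun k x => ⟨fun a => ?_, ?_⟩
    · refine (posSemidef_sum _ fun l _ =>
        (((S l).isPOVM_meas k x).1 a).mul_mul_conjTranspose_same (J l)).add ?_
      split_ifs
      · exact posSemidef_one_sub_of_mul_self hK hKK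
      · exact PosSemidef.zero
    · simp only [M, Finset.sum_add_distrib, Finset.sum_ite_eq', Finset.mem_univ, if_true]
      rw [Finset.sum_comm]
      simp_rw [← Matrix.sum_mul, ← Matrix.mul_sum, ((S _).isPOVM_meas k x).2, Matrix.mul_one]
      exact add_sub_cancel _ _
  let W : Fin N → Matrix (Fin n → Fin d') (Fin n → Fin d) ℂ := fun l => rectTensor fun _ => J l
  have hWW : ∀ l, (W l)ᴴ * W l = 1 := by
    intro l
    simp only [W, conjTranspose_rectTensor, rectTensor_mul, hJJ, if_true]
    exact rectTensor_one
  have htr : ∀ l (T : Matrix (Fin n → Fin d') (Fin n → Fin d') ℂ),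
      (W l * (S l).state * (W l)ᴴ * T).trace = ((S l).state * ((W l)ᴴ * T * W l)).trace := by
    intro l T
    rw [Matrix.mul_assoc (W l), Matrix.mul_assoc (W l), trace_mul_comm (W l)]
    simp only [Matrix.mul_assoc]
  refine ⟨{ state := ∑ l, (p l : ℂ) • (W l * (S l).state * (W l)ᴴ)
            meas := M
            isDensityMatrix_state := ⟨posSemidef_sum _ fun l _ =>
              ((S l).isDensityMatrix_state.1.mul_mul_conjTranspose_same (W l)).smul
                (Complex.zero_le_real.2 (hp.1 l)), ?_⟩
            isPOVM_meas := hM }, fun x a => ?_⟩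
  · have h1 : ∀ l, (W l * (S l).state * (W l)ᴴ).trace = 1 := by
      intro l
      have h2 := htr l 1
      rw [Matrix.mul_one, Matrix.mul_one, hWW, Matrix.mul_one] at h2
      rw [h2, (S l).isDensityMatrix_state.2]
    simp only [trace_sum, trace_smul, h1, smul_eq_mul, mul_one]
    exact_mod_cast hp.2
  · rw [hPS, Strategy.prob, Matrix.sum_mul, trace_sum]
    refine Finset.sum_congr rfl fun l _ => ?_
    rw [Matrix.smul_mul, trace_smul, smul_eq_mul, htr, Strategy.prob]
    simp only [W, conjTranspose_rectTensor, tensor_eq_rectTensor, rectTensor_mul, hJM]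

/-! ### The Fenchel–Bunt theorem -/

/-- Convex combinations of at most `N` points can be padded to combinations of `N` points. -/
theorem exists_stdSimplex_fin_of_card_le {E ι : Type*} [AddCommGroup E] [Module ℝ E] [Fintype ι]
    {S : Set E} {w : ι → ℝ} {z : ι → E} (hw : ∀ i, 0 ≤ w i) (hw1 : ∑ i, w i = 1)
    (hz : ∀ i, z i ∈ S) {N : ℕ} (hN : Fintype.card ι ≤ N) :
    ∃ p ∈ stdSimplex ℝ (Fin N), ∃ y : Fin N → E, (∀ i, y i ∈ S) ∧
      ∑ i, p i • y i = ∑ i, w i • z i := by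
  classical
  have hne : Nonempty ι := by
    by_contra h
    rw [not_nonempty_iff] at h
    simp at hw1
  obtain ⟨i₀⟩ := hne
  let e : ι → Fin N := fun i => Fin.castLE hN (Fintype.equivFin ι i)
  have he : Function.Injective e :=
    (Fin.castLE_injective hN).comp (Fintype.equivFin ι).injective
  let p : Fin N → ℝ := Function.extend e w fun _ => 0
  have hp : ∀ i, p (e i) = w i := fun i => he.extend_apply w _ i
  have hp0 : ∀ j ∉ Set.range e, p j = 0 := fun j hj => Function.extend_apply' w _ j hj
  let y : Fin N → E := Function.extend e z fun _ => z i₀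
  have hy : ∀ i, y (e i) = z i := fun i => he.extend_apply z _ i
  refine ⟨p, ⟨fun j => ?_, ?_⟩, y, fun j => ?_, ?_⟩
  · by_cases hj : j ∈ Set.range e
    · obtain ⟨i, rfl⟩ := hj
      exact (hp i).symm ▸ hw i
    · exact (hp0 j hj).ge
  · rw [← hw1]
    exact (Fintype.sum_of_injective e he _ _ hp0 fun i => (hp i).symm).symm
  · by_cases hj : j ∈ Set.range e
    · obtain ⟨i, rfl⟩ := hj
      exact (hy i).symm ▸ hz i
    · have : y j = z i₀ := Function.extend_apply' z _ j hj
      exact this ▸ hz i₀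
  · exact (Fintype.sum_of_injective e he _ _ (fun j hj => by rw [hp0 j hj, zero_smul])
      fun i => by rw [hp, hy]).symm

theorem sum_subtype_ne {ι M : Type*} [Fintype ι] [DecidableEq ι] [AddCommMonoid M] (f : ι → M)
    {i₀ : ι} (h : f i₀ = 0) : ∑ i : {i // i ≠ i₀}, f i = ∑ i, f i := by
  rw [← Finset.sum_erase _ h]
  exact (Finset.sum_subtype _ (by simp) f).symm

/-- The step of the Fenchel–Bunt theorem. Let `x` be a positive combination of a basis of points of
a connected set `S` in an affine hyperplane. Replacing basis vectors by a point `y` of `S` as far as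
the weights stay nonnegative makes the weight of `z i` vanish for every `i` that maximises
`(coordinate of y) / (w i)`. By connectedness this maximum is attained twice for some `y`, and then
one point replaces two. -/
theorem exists_exchange_of_isPreconnected {E ι : Type*} [NormedAddCommGroup E] [NormedSpace ℝ E]
    [FiniteDimensional ℝ E] [Fintype ι] [DecidableEq ι] {S : Set E} (hS : IsPreconnected S)
    (φ : E →ₗ[ℝ] ℝ) (hφ : ∀ y ∈ S, φ y = 1) (b : Module.Basis ι ℝ E) (hb : ∀ i, b i ∈ S)
    {w : ι → ℝ} (hw : ∀ i, 0 < w i) {i₀ i₁ : ι} (hi : i₁ ≠ i₀) :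
    ∃ y ∈ S, ∃ τ : ℝ, 0 ≤ τ ∧ (∀ i, 0 ≤ w i - τ * b.repr y i) ∧ w i₀ - τ * b.repr y i₀ = 0 ∧
      ∃ i₂ ≠ i₀, w i₂ - τ * b.repr y i₂ = 0 := by
  have hne : (Finset.univ.erase i₀).Nonempty := ⟨i₁, by simp [hi]⟩
  let r : ι → E → ℝ := fun i y => b.repr y i / w i
  have hr : ∀ i, Continuous (r i) := fun i =>
    (LinearMap.continuous_of_finiteDimensional (b.coord i)).div_const _
  let F : E → ℝ := fun y => (Finset.univ.erase i₀).sup' hne (fun i => r i y) - r i₀ y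
  have hF : Continuous F := (Continuous.finset_sup'_apply hne fun i _ => hr i).sub (hr i₀)
  have h0 : F (b i₀) ≤ 0 := by
    have h1 : (Finset.univ.erase i₀).sup' hne (fun i => r i (b i₀)) ≤ 0 := by
      refine Finset.sup'_le hne _ fun i hi => ?_
      simp [r, (Finset.ne_of_mem_erase hi).symm]
    have h2 : 0 ≤ r i₀ (b i₀) := by simp [r, (hw i₀).le]
    exact sub_nonpos.2 (h1.trans h2)
  have h1 : 0 ≤ F (b i₁) := by
    have h1 : r i₁ (b i₁) ≤ (Finset.univ.erase i₀).sup' hne (fun i => r i (b i₁)) :=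
      Finset.le_sup' (fun i => r i (b i₁)) (by simp [hi])
    have h2 : 0 ≤ r i₁ (b i₁) := by simp [r, (hw i₁).le]
    have h3 : r i₀ (b i₁) = 0 := by simp [r, hi]
    exact sub_nonneg.2 (h3 ▸ h2.trans h1)
  obtain ⟨y, hy, hFy⟩ := hS.intermediate_value (hb i₀) (hb i₁) hF.continuousOn ⟨h0, h1⟩
  obtain ⟨i₂, hi₂, hsup⟩ := Finset.exists_mem_eq_sup' hne fun i => r i y
  have ht : r i₂ y = r i₀ y := by
    rw [← hsup]
    exact sub_eq_zero.1 hFy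
  have hmax : ∀ i, r i y ≤ r i₀ y := by
    intro i
    by_cases h : i = i₀
    · rw [h]
    · rw [← ht, ← hsup]
      exact Finset.le_sup' (fun i => r i y) (by simp [h])
  have hsum : ∑ i, b.repr y i = 1 := by
    have h2 := hφ y hy
    rw [← b.sum_repr y, map_sum] at h2
    simpa [hφ _ (hb _)] using h2
  have hpos : 0 < r i₀ y := by
    by_contra! hle
    have h2 : ∀ i, b.repr y i ≤ 0 := by
      intro i
      have h3 := (div_le_iff₀ (hw i)).1 ((hmax i).trans hle)
      rwa [zero_mul] at h3
    linarith [Finset.sum_nonpos fun i (_ : i ∈ Finset.univ) => h2 i]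
  have hzero : ∀ i, r i y = r i₀ y → w i - (r i₀ y)⁻¹ * b.repr y i = 0 := by
    intro i h
    have h2 : b.repr y i = r i₀ y * w i := by
      rw [← h]
      exact (div_mul_cancel₀ _ (hw i).ne').symm
    rw [h2, inv_mul_cancel_left₀ hpos.ne', sub_self]
  refine ⟨y, hy, (r i₀ y)⁻¹, (inv_pos.2 hpos).le, fun i => ?_, hzero i₀ rfl, i₂,
    Finset.ne_of_mem_erase hi₂, hzero i₂ ht⟩
  rw [sub_nonneg, inv_mul_le_iff₀ hpos]
  exact (div_le_iff₀ (hw i)).1 (hmax i)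

/-- The Fenchel–Bunt theorem: for a connected set in an affine hyperplane of an
`(m + 1)`-dimensional space, convex combinations of `m` points suffice, one fewer than in Carathéodory's theorem. The
exception is `m = 0`, where one point is needed. -/
theorem exists_stdSimplex_of_mem_convexHull_of_isPreconnected {E : Type*} [NormedAddCommGroup E]
    [NormedSpace ℝ E] [FiniteDimensional ℝ E] {S : Set E} (hS : IsPreconnected S)
    (φ : E →ₗ[ℝ] ℝ) (hφ : ∀ y ∈ S, φ y = 1) {m : ℕ} (hm : Module.finrank ℝ E ≤ m + 1) {x : E}
    (hx : x ∈ convexHull ℝ S) :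
    ∃ p ∈ stdSimplex ℝ (Fin (max 1 m)), ∃ y : Fin (max 1 m) → E, (∀ i, y i ∈ S) ∧
      ∑ i, p i • y i = x := by
  classical
  obtain ⟨ι, _, z, w, hzS, hz, hw, hw1, hwx⟩ := eq_pos_convex_span_of_mem_convexHull hx
  have hzS' : ∀ i, z i ∈ S := fun i => hzS ⟨i, rfl⟩
  have hlin : LinearIndependent ℝ z := by
    rw [linearIndependent_iff']
    intro s g hg
    refine affineIndependent_iff.1 hz s g ?_ hg
    have h := congrArg φ hg
    simpa [hφ _ (hzS' _)] using h
  have hcard := hlin.fintype_card_le_finrank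
  by_cases hsmall : Fintype.card ι ≤ max 1 m
  · rw [← hwx]
    exact exists_stdSimplex_fin_of_card_le (fun i => (hw i).le) hw1 hzS' hsmall
  have hbig : 1 < Fintype.card ι := (le_max_left 1 m).trans_lt (not_le.1 hsmall)
  have hbig' : m < Fintype.card ι := (le_max_right 1 m).trans_lt (not_le.1 hsmall)
  have hcard' : Fintype.card ι = Module.finrank ℝ E := by omega
  obtain ⟨i₀, i₁, hi⟩ := Fintype.exists_pair_of_one_lt_card hbig
  have : Nonempty ι := ⟨i₀⟩
  let b := basisOfLinearIndependentOfCardEqFinrank hlin hcard'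
  have hb : ∀ i, b i = z i := fun i => by simp [b]
  obtain ⟨y, hy, τ, hτ, hw', hi₀, i₂, hi₂, hi₂'⟩ := exists_exchange_of_isPreconnected hS φ hφ b
    (fun i => (hb i).symm ▸ hzS' i) hw hi.symm
  let w' : ι → ℝ := fun i => w i - τ * b.repr y i
  have hsum' : τ • y + ∑ i, w' i • z i = x := by
    have h2 : y = ∑ i, b.repr y i • z i := by
      conv_lhs => rw [← b.sum_repr y]
      simp [hb]
    have h3 : τ • y = ∑ i, (τ * b.repr y i) • z i := by
      conv_lhs => rw [h2]
      simp only [Finset.smul_sum, mul_smul]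
    rw [h3, ← Finset.sum_add_distrib, ← hwx]
    refine Finset.sum_congr rfl fun i _ => ?_
    rw [← add_smul, add_sub_cancel]
  have hsum1 : τ + ∑ i, w' i = 1 := by
    have h2 := congrArg φ hsum'
    rw [← hwx] at h2
    simpa [hφ _ (hzS' _), hφ _ hy, hw1] using h2
  -- The point `y` takes the place of `z i₂`, and `z i₀` is dropped.
  let q : {i // i ≠ i₀} → ℝ := fun i => w' i + if i.1 = i₂ then τ else 0
  let u : {i // i ≠ i₀} → E := fun i => if i.1 = i₂ then y else z i
  have hq1 : ∑ i, q i = 1 := by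
    rw [← hsum1, sum_subtype_ne (fun i => w' i + if i = i₂ then τ else 0)
      (by simp [w', hi₀, hi₂.symm]),
      Finset.sum_add_distrib, add_comm]
    simp
  have hqu : ∑ i, q i • u i = x := by
    have h2 : ∀ i, q i • u i = w' i • z i + if i.1 = i₂ then τ • y else 0 := by
      intro i
      by_cases h : i.1 = i₂
      · have h3 : w' i₂ = 0 := hi₂'
        simp [q, u, h, h3]
      · simp [q, u, h]
    simp only [h2]
    rw [← hsum', sum_subtype_ne (fun i => w' i • z i + if i = i₂ then τ • y else 0)
      (by simp [w', hi₀, hi₂.symm]), Finset.sum_add_distrib, add_comm]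
    simp
  rw [← hqu]
  refine exists_stdSimplex_fin_of_card_le (w := q)
    (fun i => add_nonneg (hw' i) ?_) hq1 (fun i => ?_) ?_
  · split_ifs
    exacts [hτ, le_rfl]
  · simp only [u]
    split_ifs
    exacts [hy, hzS' _]
  · rw [Fintype.card_subtype_compl (· = i₀), Fintype.card_subtype_eq]
    omega

/-! ### Correlators -/

/-- The identity and the effects of outcome `0`; they determine two-outcome measurements `A 0` and
`A 1`. -/
def effect {d : ℕ} (A : Fin 2 → Fin 2 → Matrix (Fin d) (Fin d) ℂ) :
    Fin 3 → Matrix (Fin d) (Fin d) ℂ :=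
  ![1, A 0 0, A 1 0]

/-- The coefficients of `A x a` with respect to `effect A`. -/
def effectCoeff (x a : Fin 2) : Fin 3 → ℝ :=
  if a = 0 then Pi.single x.succ 1 else Pi.single 0 1 - Pi.single x.succ 1

theorem sum_effectCoeff_smul_effect {d : ℕ} {A : Fin 2 → Fin 2 → Matrix (Fin d) (Fin d) ℂ}
    (hA : ∀ x, IsPOVM (A x)) (x a : Fin 2) : ∑ c, effectCoeff x a c • effect A c = A x a := by
  have h1 : A x 1 = 1 - A x 0 := by
    rw [← (hA x).2, Fin.sum_univ_two]
    abel
  have h2 : ∀ x : Fin 2, effect A x.succ = A x 0 := by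
    intro x
    fin_cases x <;> rfl
  have h3 : ∀ i, ∑ c, (Pi.single i 1 : Fin 3 → ℝ) c • effect A c = effect A i := by
    intro i
    simp [Pi.single_apply]
  fin_cases a
  · simp only [effectCoeff, Fin.zero_eta, if_true, h3, h2]
  · simp only [effectCoeff, Fin.mk_one, one_ne_zero, if_false, Pi.sub_apply, sub_smul,
      Finset.sum_sub_distrib, h3, h2, h1]
    rfl

/-- The joint expectations `Re Tr (ρ (E₁ ⊗ ⋯ ⊗ Eₙ))`, where every `Eₖ` is the identity or the effect
of outcome `0` in one of the two settings of party `k`. -/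
noncomputable def correlator {n d : ℕ} (ρ : Matrix (Fin n → Fin d) (Fin n → Fin d) ℂ)
    (A : Fin n → Fin 2 → Fin 2 → Matrix (Fin d) (Fin d) ℂ) : (Fin n → Fin 3) → ℝ :=
  fun c => (ρ * tensor fun k => effect (A k) (c k)).trace.re

/-- The boxes as linear functions of the correlators. -/
noncomputable def boxOfCorrelator (n : ℕ) : ((Fin n → Fin 3) → ℝ) →ₗ[ℝ] Box n 2 2 where
  toFun E := fun x a => ∑ c, (∏ k, effectCoeff (x k) (a k) (c k)) * E c
  map_add' E E' := by
    funext x a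
    simp [mul_add, Finset.sum_add_distrib]
  map_smul' t E := by
    funext x a
    simp [Finset.mul_sum, mul_left_comm]

theorem Strategy.boxOfCorrelator_correlator {n d : ℕ} (S : Strategy n 2 2 d) :
    boxOfCorrelator n (correlator S.state S.meas) = S.box := by
  funext x a
  have h : tensor (fun k => S.meas k (x k) (a k)) = ∑ c : Fin n → Fin 3,
      (∏ k, effectCoeff (x k) (a k) (c k)) • tensor fun k => effect (S.meas k) (c k) := by
    simp_rw [← sum_effectCoeff_smul_effect (S.isPOVM_meas _)]
    rw [tensor_eq_rectTensor,
      rectTensor_sum fun k c => effectCoeff (x k) (a k) c • effect (S.meas k) c]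
    refine Finset.sum_congr rfl fun c _ => ?_
    ext i j
    simp [rectTensor, tensor, Finset.prod_mul_distrib]
  simp only [Strategy.box, Strategy.prob, h, Matrix.mul_sum, trace_sum, Complex.re_sum,
    Matrix.mul_smul, trace_smul, Complex.smul_re, smul_eq_mul]
  rfl

/-- The correlators of the strategies with local dimension `d`. -/
def correlatorSet (n d : ℕ) : Set ((Fin n → Fin 3) → ℝ) :=
  Set.range fun S : Strategy n 2 2 d => correlator S.state S.meas

theorem image_boxOfCorrelator_correlatorSet (n d : ℕ) :
    boxOfCorrelator n '' correlatorSet n d = quantumSet n 2 2 d := by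
  ext P
  rw [mem_quantumSet_iff, correlatorSet, ← Set.range_comp]
  simp only [Set.mem_range, Function.comp_apply, Strategy.boxOfCorrelator_correlator, eq_comm]

theorem correlator_zero {n d : ℕ} (S : Strategy n 2 2 d) : correlator S.state S.meas 0 = 1 := by
  have h : (tensor fun k => effect (S.meas k) ((0 : Fin n → Fin 3) k)) = 1 := rectTensor_one
  rw [correlator, h, Matrix.mul_one, S.isDensityMatrix_state.2, Complex.one_re]

theorem convex_setOf_isDensityMatrix {ι : Type} [Fintype ι] :
    Convex ℝ {ρ : Matrix ι ι ℂ | IsDensityMatrix ρ} := by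
  rintro ρ ⟨hρ, hρ'⟩ ρ' ⟨hσ, hσ'⟩ s t hs ht hst
  refine ⟨(hρ.smul hs).add (hσ.smul ht), ?_⟩
  rw [trace_add, trace_smul, trace_smul, hρ', hσ', ← add_smul, hst, one_smul]

theorem convex_setOf_isPOVM {d v : ℕ} :
    Convex ℝ {A : Fin v → Matrix (Fin d) (Fin d) ℂ | IsPOVM A} := by
  rintro A ⟨hA, hA'⟩ B ⟨hB, hB'⟩ s t hs ht hst
  refine ⟨fun a => ((hA a).smul hs).add ((hB a).smul ht), ?_⟩
  simp only [Pi.add_apply, Pi.smul_apply, Finset.sum_add_distrib, ← Finset.smul_sum, hA', hB',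
    ← add_smul, hst, one_smul]

/-- The correlators depend continuously on the state and the measurements, which range over a
convex set. -/
theorem isPreconnected_correlatorSet (n d : ℕ) : IsPreconnected (correlatorSet n d) := by
  let X : Set (Matrix (Fin n → Fin d) (Fin n → Fin d) ℂ ×
      (Fin n → Fin 2 → Fin 2 → Matrix (Fin d) (Fin d) ℂ)) :=
    {ρ | IsDensityMatrix ρ} ×ˢ
      Set.univ.pi fun _ => Set.univ.pi fun _ => {A | IsPOVM A}
  have hX : Convex ℝ X := convex_setOf_isDensityMatrix.prod
    (convex_pi fun _ _ => convex_pi fun _ _ => convex_setOf_isPOVM)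
  have hcont : Continuous fun q : Matrix (Fin n → Fin d) (Fin n → Fin d) ℂ ×
      (Fin n → Fin 2 → Fin 2 → Matrix (Fin d) (Fin d) ℂ) => correlator q.1 q.2 := by
    have heff : ∀ c : Fin 3, Continuous fun A : Fin 2 → Fin 2 → Matrix (Fin d) (Fin d) ℂ =>
        effect A c := by
      intro c
      fin_cases c
      · exact continuous_const
      · exact (continuous_apply 0).comp (continuous_apply 0)
      · exact (continuous_apply 0).comp (continuous_apply 1)
    refine continuous_pi fun c => Complex.continuous_re.comp ?_
    refine Continuous.matrix_trace (continuous_fst.matrix_mul ?_)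
    refine continuous_matrix fun i j => ?_
    change Continuous fun q : Matrix (Fin n → Fin d) (Fin n → Fin d) ℂ ×
      (Fin n → Fin 2 → Fin 2 → Matrix (Fin d) (Fin d) ℂ) =>
        ∏ k, effect (q.2 k) (c k) (i k) (j k)
    refine continuous_finsetProd _ fun k _ => ?_
    exact ((heff (c k)).comp ((continuous_apply k).comp continuous_snd)).matrix_elem (i k) (j k)
  have himage : correlatorSet n d = (fun q => correlator q.1 q.2) '' X := by
    ext E
    constructor
    · rintro ⟨S, rfl⟩
      exact ⟨(S.state, S.meas), ⟨S.isDensityMatrix_state, fun k _ x _ => S.isPOVM_meas k x⟩, rfl⟩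
    · rintro ⟨⟨ρ, A⟩, ⟨hρ, hA⟩, rfl⟩
      exact ⟨⟨ρ, A, hρ, fun k x => hA k trivial x trivial⟩, rfl⟩
  rw [himage]
  exact hX.isPreconnected.image _ hcont.continuousOn

/-! ### Convexity of the quantum sets -/

/-- The correlators lie in a hyperplane of a space of dimension `3 ^ n`, so `3 ^ n - 1` values of
shared randomness suffice (and one when `n = 0`). -/
theorem max_one_mem_convexifyingSizes (n d : ℕ) :
    max 1 (3 ^ n - 1) ∈ convexifyingSizes n 2 2 d := by
  refine hybridSet_subset_convexHull.antisymm fun P hP => ?_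
  rw [← image_boxOfCorrelator_correlatorSet, ← LinearMap.image_convexHull] at hP
  obtain ⟨E, hE, rfl⟩ := hP
  have hdim : Module.finrank ℝ ((Fin n → Fin 3) → ℝ) ≤ 3 ^ n - 1 + 1 := by
    simp only [Module.finrank_fintype_fun_eq_card, Fintype.card_pi, Fintype.card_fin,
      Finset.prod_const, Finset.card_univ]
    omega
  obtain ⟨p, hp, y, hy, rfl⟩ := exists_stdSimplex_of_mem_convexHull_of_isPreconnected
    (isPreconnected_correlatorSet n d) (LinearMap.proj 0)
    (by rintro _ ⟨S, rfl⟩; exact correlator_zero S) hdim hE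
  choose S hS using hy
  refine mem_hybridSet_iff.2 ⟨p, hp, S, ?_⟩
  simp only [map_sum, map_smul, ← hS, Strategy.boxOfCorrelator_correlator]

/-- `conv Q₂ = L_N + Q₂ ⊆ Q_d' ⊆ conv Q₂` as soon as `2 * N ≤ d'`. -/
theorem convex_quantumSet_of_mem_convexifyingSizes {n N d' : ℕ}
    (hN : N ∈ convexifyingSizes n 2 2 2) (h : 2 * N ≤ d') : Convex ℝ (quantumSet n 2 2 d') := by
  have h1 : quantumSet n 2 2 d' = convexHull ℝ (quantumSet n 2 2 2) := by
    refine (quantumSet_subset_convexHull_quantumSet_two n d').antisymm ?_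
    have hN' : hybridSet n 2 2 N 2 = convexHull ℝ (quantumSet n 2 2 2) := hN
    rw [← hN']
    exact hybridSet_subset_quantumSet (by omega)
  rw [h1]
  exact convex_convexHull ℝ _

/-- Without parties, the only box assigns probability one to the empty tuple of outcomes. -/
theorem convex_quantumSet_zero (d : ℕ) : Convex ℝ (quantumSet 0 2 2 d) := by
  have h : ∀ (S : Strategy 0 2 2 d) x a, S.box x a = 1 := by
    intro S x a
    have h1 : (tensor fun k => S.meas k (x k) (a k)) = 1 := by
      rw [tensor_eq_rectTensor, ← rectTensor_one]
      congr 1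
      exact Subsingleton.elim _ _
    rw [Strategy.box, Strategy.prob, h1, Matrix.mul_one, S.isDensityMatrix_state.2, Complex.one_re]
  refine Set.Subsingleton.convex fun P hP P' hP' => ?_
  obtain ⟨S, rfl⟩ := mem_quantumSet_iff.1 hP
  obtain ⟨S', rfl⟩ := mem_quantumSet_iff.1 hP'
  funext x a
  rw [h, h]

end BellScenario

theorem mainTheorem4 (n : ℕ) :
    (BellScenario.convexifyingSizes n 2 2 2).Nonempty ∧
    (∀ d' : ℕ, 2 * (3 ^ n - 1) ≤ d' → Convex ℝ (BellScenario.quantumSet n 2 2 d')) ∧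
    (∀ d' : ℕ, 2 * BellScenario.quantumCaratheodoryNumber n 2 2 2 ≤ d' →
      Convex ℝ (BellScenario.quantumSet n 2 2 d')) := by
  have hmem := BellScenario.max_one_mem_convexifyingSizes n 2
  refine ⟨⟨_, hmem⟩, fun d' hd' => ?_, fun d' hd' =>
    BellScenario.convex_quantumSet_of_mem_convexifyingSizes (Nat.sInf_mem ⟨_, hmem⟩) hd'⟩
  rcases Nat.eq_zero_or_pos n with rfl | hn
  · exact BellScenario.convex_quantumSet_zero d'
  · have h3 : 3 ≤ 3 ^ n := Nat.le_self_pow hn.ne' 3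
    rw [max_eq_right (by omega)] at hmem
    exact BellScenario.convex_quantumSet_of_mem_convexifyingSizes hmem hd'
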